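/- Let $K$ be a field, $n\ge 3$ an integer, $S=K[x_1,\dots,x_n]$ with its standard $\mathbb{Z}^n$-grading and $\mathfrak m=(x_1,\dots,x_n)$. For $1\le m\le n$ let $J_{n,m}\subset S$ be the path ideal of length $m$ of the $n$-cycle $C_n$ (vertices $x_1,\dots,x_n$, edges $x_ix_{i+1}$ for $1\le i\le n-1$ and $x_nx_1$), that is, the ideal generated by the products of the variables along the paths of $C_n$ with exactly $m$ vertices; for $m<n$ these are the products $x_i x_{i+1}\cdots x_{i+m-1}$, $1\le i\le n$, with indices taken modulo $n$. For a finitely generated $\mathbb{Z}^n$-graded $S$-module $M\neq 0$ put $\operatorname{depth}(M)=\min\{i\ge 0 : \operatorname{Ext}^i_S(S/\mathfrak m,M)\ne 0\}$. A Stanley decomposition of $M$ is a decomposition $M=\bigoplus_{i=1}^r u_iK[Z_i]$ as a finite direct sum of $K$-vector spaces, where each $u_i\in M$ is homogeneous, $Z_i\subseteq\{x_1,\dots,x_n\}$, and $u_iK[Z_i]$, the $K$-span of the elements $u_iv$ with $v$ a monomial of $K[Z_i]$, is a free $K[Z_i]$-module with basis $u_i$; its Stanley depth is $\min_i|Z_i|$,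 and $\operatorname{sdepth}(M)$ is the maximum of the Stanley depths of all Stanley decompositions of $M$. **Proposition 3.2.** 1. $n-3\le \operatorname{sdepth}(S/J_{n,n-2})\le n-2$; 2. $n-3\le \operatorname{depth}(S/J_{n,n-2})\le n-2$. -/

import Mathlib

open CategoryTheory

universe u

/-- The path ideal of a graph `G` on the vertices `V` for paths of length `m`, where (as in the
theory of path ideals) the length of a path is its number of vertices: the ideal of `K[x_v | v ∈ V]`
generated by the products of the variables along the paths of `G` with exactly `m` vertices. -/
noncomputable def pathIdeal (K : Type u) [CommRing K] {V : Type} (G : SimpleGraph V) (m : ℕ) :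
    Ideal (MvPolynomial V K) :=
  Ideal.span {f | ∃ (a b : V) (p : G.Walk a b), p.IsPath ∧ p.support.length = m ∧
    f = (p.support.map MvPolynomial.X).prod}

/-- `J_{n,m} ⊆ K[x_0, …, x_{n-1}]`: the path ideal of length `m` of the `n`-cycle. -/
noncomputable def cyclePathIdeal (K : Type u) [CommRing K] (n m : ℕ) :
    Ideal (MvPolynomial (Fin n) K) :=
  pathIdeal K (SimpleGraph.cycleGraph n) m

/-- The least `i` with `Ext^i_R(R/I, M) ≠ 0` (and `⊤` if there is none). -/
noncomputable def extDepth {R : Type u} [CommRing R] (I : Ideal R) (M : Type u) [AddCommGroup M]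
    [Module R M] : ℕ∞ :=
  ⨅ (i : ℕ) (_ : Nontrivial (Abelian.Ext (ModuleCat.of R (R ⧸ I)) (ModuleCat.of R M) i)), (i : ℕ∞)

/-- `depth (S/I)` for a proper homogeneous ideal `I` of the polynomial ring
`S = K[x_0, …, x_{n-1}]` over a field `K`: the least `i` with `Ext^i_S(S/𝔪, S/I) ≠ 0`, where
`𝔪 = (x_0, …, x_{n-1})` is the graded maximal ideal. -/
noncomputable def depthQuotient {K : Type u} [CommRing K] {n : ℕ}
    (I : Ideal (MvPolynomial (Fin n) K)) : ℕ∞ :=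
  extDepth (MvPolynomial.idealOfVars (Fin n) K) (MvPolynomial (Fin n) K ⧸ I)

section Stanley

/- In the notions of this section the base ring `K` is a field; the code does not need this. -/
variable (K : Type u) [CommRing K] {n : ℕ} {M : Type u} [AddCommGroup M] [Module K M]
  [Module (MvPolynomial (Fin n) K) M] [IsScalarTower K (MvPolynomial (Fin n) K) M]

/-- `u K[Z]`: the `K`-span of the elements `v u`, `v` a monomial in the variables from `Z`. -/
def stanleySpan (u : M) (Z : Finset (Fin n)) : Submodule K M :=
  Submodule.span K {w | ∃ b : Fin n →₀ ℕ, b.support ⊆ Z ∧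
    w = (MvPolynomial.monomial b (1 : K)) • u}

/-- A Stanley decomposition of a module `M` over `K[x_0, …, x_{n-1}]` that is `ℤ^n`-graded with
homogeneous components `𝓜 a`: finitely many homogeneous elements `u i` and sets of variables `Z i`
such that `u i K[Z i]` is free over `K[Z i]` with basis `u i`, and `M` is the direct sum of the
`K`-subspaces `u i K[Z i]`. -/
structure StanleyDecomposition (𝓜 : (Fin n → ℤ) → Submodule K M) where
  /-- the number of Stanley spaces -/
  r : ℕ
  /-- the generators -/
  u : Fin r → M
  /-- the sets of variables -/
  Z : Fin r → Finset (Fin n)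
  homogeneous : ∀ i, ∃ a, u i ∈ 𝓜 a
  free : ∀ i, ∀ p ∈ MvPolynomial.supported K (Z i : Set (Fin n)), p • u i = 0 → p = 0
  isInternal : DirectSum.IsInternal fun i => stanleySpan K (u i) (Z i)

variable {K}

/-- The Stanley depth of a decomposition: the least dimension `|Z i|` of its Stanley spaces. -/
noncomputable def StanleyDecomposition.sdepth {𝓜 : (Fin n → ℤ) → Submodule K M}
    (D : StanleyDecomposition K 𝓜) : ℕ∞ :=
  ⨅ i, ((D.Z i).card : ℕ∞)

/-- The Stanley depth of a graded module: the largest Stanley depth of a Stanley decomposition. -/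
noncomputable def stanleyDepth (𝓜 : (Fin n → ℤ) → Submodule K M) : ℕ∞ :=
  ⨆ D : StanleyDecomposition K 𝓜, D.sdepth

/-- The component of degree `a ∈ ℤ^n` of `S/I`, for a monomial ideal `I` of
`S = K[x_0, …, x_{n-1}]`: it is spanned by the residue class of the monomial `x^a` if all the
entries of `a` are nonnegative, and it is zero otherwise. -/
noncomputable def quotientGrading (I : Ideal (MvPolynomial (Fin n) K)) (a : Fin n → ℤ) :
    Submodule K (MvPolynomial (Fin n) K ⧸ I) :=
  Submodule.span K {w | ∃ b : Fin n →₀ ℕ, (∀ i, (b i : ℤ) = a i) ∧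
    w = Ideal.Quotient.mk I (MvPolynomial.monomial b (1 : K))}

/-- `sdepth (S/I)` for a monomial ideal `I` of the polynomial ring `S = K[x_0, …, x_{n-1}]`. -/
noncomputable def sdepthQuotient (I : Ideal (MvPolynomial (Fin n) K)) : ℕ∞ :=
  stanleyDepth (quotientGrading I)

end Stanley

/-! Put d = n - 2. Deleting one vertex of the cycle leaves a path on d + 1 vertices, so the ideal I
is generated by squarefree monomials of degree d and contains all those of degree d + 1. Hence a
monomial outside I involves at most d variables. Only this is used about the cycle.

Lower bounds: the monomials outside I are partitioned into cells x^a K[Z] with |Z| ≥ d - 1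
(`skeletonPartition`). If at most d - 1 variables occur, T consists of the last n - d + 1 missing
variables; if exactly d occur, T consists of all missing ones. In both cases Z is the complement of
T. The partition is itself a Stanley decomposition. Adjoining the generators of the cells to I in
order of increasing rank gives a chain of ideals up to S whose successive quotients are S/(x_j : j ∉
Z). Long exact sequences then make Ext^k(K, S/I) vanish for k < d - 1
(`CellPartition.subsingleton_ext`).

Upper bounds: a Stanley space u K[Z] contains u times the product of the variables in Z, a nonzero
class of a monomial involving all of Z up to a scalar, so |Z| ≤ d. If Ext vanished through degree d,
there would be a regular sequence of length d + 1 on S/I, exceeding its Krull dimension, which is at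
most d. -/

/-! ### Vanishing of Ext along short exact sequences -/

section Ext

open Abelian

variable {R : Type u} [CommRing R]

/-- For `x ∈ R` and an ideal `I`, the short exact sequence
`0 → R ⧸ (I : x) → R ⧸ I → R ⧸ (I + (x)) → 0`. -/
noncomputable def colonShortComplex (x : R) {P I I' : Ideal R} (hP : ∀ f ∈ P, x * f ∈ I)
    (hI' : I' = Ideal.span {x} ⊔ I) : ShortComplex (ModuleCat.{u} R) where
  X₁ := ModuleCat.of R (R ⧸ P)
  X₂ := ModuleCat.of R (R ⧸ I)
  X₃ := ModuleCat.of R (R ⧸ I')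
  f := ModuleCat.ofHom (Submodule.mapQ P I (LinearMap.lsmul R R x) fun f hf => hP f hf)
  g := ModuleCat.ofHom (Submodule.mapQ I I' LinearMap.id fun f hf => by
    rw [hI']; exact Ideal.mem_sup_right hf)
  zero := by
    refine ModuleCat.hom_ext (LinearMap.ext fun y => ?_)
    obtain ⟨y, rfl⟩ := Submodule.Quotient.mk_surjective _ y
    change Submodule.Quotient.mk (p := I') (x * y) = 0
    rw [Submodule.Quotient.mk_eq_zero, hI']
    exact Ideal.mem_sup_left (Ideal.mul_mem_right _ _ (Ideal.mem_span_singleton_self x))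

lemma colonShortComplex_shortExact (x : R) {P I I' : Ideal R} (hP : ∀ f ∈ P, x * f ∈ I)
    (hP' : ∀ f, x * f ∈ I → f ∈ P) (hI' : I' = Ideal.span {x} ⊔ I) :
    (colonShortComplex x hP hI').ShortExact where
  exact := by
    rw [ShortComplex.moduleCat_exact_iff]
    intro y hy
    obtain ⟨y, rfl⟩ := Submodule.Quotient.mk_surjective _ y
    change Submodule.Quotient.mk (p := I') y = 0 at hy
    rw [Submodule.Quotient.mk_eq_zero, hI', Ideal.mem_span_singleton_sup] at hy
    obtain ⟨a, b, hb, rfl⟩ := hy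
    refine ⟨Submodule.Quotient.mk a, (Submodule.Quotient.eq I).2 ?_⟩
    have : x * a - (a * x + b) = -b := by ring
    change x * a - (a * x + b) ∈ I
    rw [this]
    exact neg_mem hb
  mono_f := by
    rw [ModuleCat.mono_iff_injective, injective_iff_map_eq_zero]
    intro y hy
    obtain ⟨y, rfl⟩ := Submodule.Quotient.mk_surjective _ y
    change Submodule.Quotient.mk (p := I) (x * y) = 0 at hy
    rw [Submodule.Quotient.mk_eq_zero] at hy
    exact (Submodule.Quotient.mk_eq_zero _).2 (hP' _ hy)
  epi_g := by
    rw [ModuleCat.epi_iff_surjective]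
    intro y
    obtain ⟨y, rfl⟩ := Submodule.Quotient.mk_surjective _ y
    exact ⟨Submodule.Quotient.mk y, rfl⟩

lemma subsingleton_ext_of_shortExact {S : ShortComplex (ModuleCat.{u} R)} (hS : S.ShortExact)
    (N : ModuleCat.{u} R) (i : ℕ) (h₁ : Subsingleton (Ext N S.X₁ i))
    (h₃ : Subsingleton (Ext N S.X₃ i)) : Subsingleton (Ext N S.X₂ i) := by
  refine subsingleton_of_forall_eq 0 fun y => ?_
  obtain ⟨z, rfl⟩ := Ext.covariant_sequence_exact₂ N hS y (Subsingleton.elim _ _)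
  rw [Subsingleton.elim z 0, Ext.zero_comp]

/-- If `x` is a nonzerodivisor on `R ⧸ P` which annihilates `N`, then `Ext^i(N, R ⧸ P)` vanishes
as soon as `Ext^{i-1}(N, R ⧸ (P + (x)))` does. -/
lemma subsingleton_ext_of_regular (x : R) {P P' : Ideal R} (hP : ∀ f, x * f ∈ P → f ∈ P)
    (hP' : P' = Ideal.span {x} ⊔ P) (N : ModuleCat.{u} R) (hN : x ∈ Module.annihilator R N)
    (i : ℕ) (h : ∀ j, j + 1 = i → Subsingleton (Ext N (ModuleCat.of R (R ⧸ P')) j)) :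
    Subsingleton (Ext N (ModuleCat.of R (R ⧸ P)) i) := by
  have hx : ∀ f ∈ P, x * f ∈ P := fun f hf => Ideal.mul_mem_left _ _ hf
  have hS := colonShortComplex_shortExact x hx hP hP'
  have hf : (colonShortComplex x hx hP').f = x • 𝟙 (ModuleCat.of R (R ⧸ P)) := by
    ext y
    obtain ⟨y, rfl⟩ := Submodule.Quotient.mk_surjective _ y
    rfl
  -- Multiplication by `x` on the coefficients agrees with multiplication by `x` on `N`, which is
  -- zero. So every class comes from the connecting map, or, in degree 0, vanishes by injectivity.
  have hzero : ∀ y : Ext N (ModuleCat.of R (R ⧸ P)) i,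
      y.comp (Ext.mk₀ (colonShortComplex x hx hP').f) (add_zero i) = 0 := by
    intro y
    have := congrArg (fun g => g.hom y)
      (Ext.postcomp_smul_id_eq_zero_of_mem_annihilator (M := ModuleCat.of R (R ⧸ P)) hN i)
    rw [hf]
    exact this
  refine subsingleton_of_forall_eq 0 fun y => ?_
  cases i with
  | zero =>
    have := hS.mono_f
    exact Ext.postcomp_mk₀_injective_of_mono N (colonShortComplex x hx hP').f
      ((hzero y).trans (map_zero _).symm)
  | succ j =>
    have : Subsingleton (Ext N (colonShortComplex x hx hP').X₃ j) := h j rfl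
    obtain ⟨z, hz⟩ := Ext.covariant_sequence_exact₁ N hS y (hzero y) (n₀ := j) rfl
    rw [← hz, Subsingleton.elim z 0]
    exact Ext.zero_comp ..

end Ext

/-! ### Monomial ideals, cell partitions and the filtration they give -/

section MonomialIdeal

open MvPolynomial Abelian

variable {K : Type u} {σ : Type}

lemma MvPolynomial.mem_restrictSupportIdeal [CommRing K] {U : Set (σ →₀ ℕ)} {hU : IsUpperSet U}
    {f : MvPolynomial σ K} :
    f ∈ restrictSupportIdeal (R := K) U hU ↔ ∀ m ∈ f.support, m ∈ U := Iff.rfl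

lemma MvPolynomial.monomial_mem_restrictSupportIdeal [CommRing K] [Nontrivial K]
    {U : Set (σ →₀ ℕ)} {hU : IsUpperSet U} {m : σ →₀ ℕ} :
    monomial m (1 : K) ∈ restrictSupportIdeal (R := K) U hU ↔ m ∈ U := by
  classical
  rw [mem_restrictSupportIdeal, support_monomial, if_neg one_ne_zero]
  simp

lemma MvPolynomial.monomial_mul_mem_restrictSupportIdeal [CommRing K]
    {U : Set (σ →₀ ℕ)} {hU : IsUpperSet U} {a : σ →₀ ℕ} {f : MvPolynomial σ K} :
    monomial a (1 : K) * f ∈ restrictSupportIdeal (R := K) U hU ↔ ∀ m ∈ f.support, a + m ∈ U := by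
  rw [mem_restrictSupportIdeal]
  constructor
  · intro h m hm
    apply h
    rw [mem_support_iff, coeff_monomial_mul, one_mul]
    exact mem_support_iff.1 hm
  · intro h m hm
    rw [mem_support_iff, coeff_monomial_mul'] at hm
    split_ifs at hm with ham
    · have := h (m - a) (by simpa [mem_support_iff] using hm)
      rwa [add_tsub_cancel_of_le ham] at this
    · exact absurd rfl hm

/-- The exponents of the monomials `x^a v`, `v` a monomial in the variables from `Z`. -/
def monomialCell (a : σ →₀ ℕ) (Z : Finset σ) : Set (σ →₀ ℕ) :=
  {m | ∃ b : σ →₀ ℕ, b.support ⊆ Z ∧ m = a + b}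

/-- A partition of the complement of a set `U` of exponents into cells, numbered in such a way that
the multiples of a monomial in a cell stay in that cell, or lie in a cell of smaller
rank, or lie in `U`. -/
structure CellPartition (U : Set (σ →₀ ℕ)) (ι : Type) where
  a : ι → σ →₀ ℕ
  Z : ι → Finset σ
  rank : ι → ℕ
  cover : ∀ m, m ∉ U → ∃ i, m ∈ monomialCell (a i) (Z i)
  unique : ∀ m i j, m ∈ monomialCell (a i) (Z i) → m ∈ monomialCell (a j) (Z j) → i = j
  notMem : ∀ m i, m ∈ monomialCell (a i) (Z i) → m ∉ U
  rank_lt : ∀ m m' i j, m ∈ monomialCell (a i) (Z i) → m' ∈ monomialCell (a j) (Z j) →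
    m ≤ m' → j = i ∨ rank j < rank i

lemma MvPolynomial.isUpperSet_exists_ne_zero (T : Set σ) :
    IsUpperSet {m : σ →₀ ℕ | ∃ i ∈ T, m i ≠ 0} := by
  rintro m m' h ⟨i, hi, hm⟩
  exact ⟨i, hi, fun h0 => hm (Nat.le_zero.1 ((h i).trans_eq h0))⟩

lemma MvPolynomial.span_X_image_eq_restrictSupportIdeal [CommRing K] (T : Set σ) :
    Ideal.span ((X : σ → MvPolynomial σ K) '' T) =
      restrictSupportIdeal (R := K) _ (isUpperSet_exists_ne_zero T) := by
  ext f
  rw [mem_ideal_span_X_image, mem_restrictSupportIdeal]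
  rfl

lemma MvPolynomial.mem_span_X_image_of_X_mul_mem [CommRing K] {T : Set σ} {j : σ} (hj : j ∉ T)
    {f : MvPolynomial σ K} (h : X j * f ∈ Ideal.span ((X : σ → MvPolynomial σ K) '' T)) :
    f ∈ Ideal.span ((X : σ → MvPolynomial σ K) '' T) := by
  rw [span_X_image_eq_restrictSupportIdeal, X, monomial_mul_mem_restrictSupportIdeal] at h
  rw [span_X_image_eq_restrictSupportIdeal, mem_restrictSupportIdeal]
  intro m hm
  obtain ⟨i, hi, hmi⟩ := h m hm
  refine ⟨i, hi, ?_⟩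
  have hij : j ≠ i := by rintro rfl; exact hj hi
  simpa [Finsupp.single_apply, hij] using hmi

lemma MvPolynomial.X_mem_annihilator_quotient_idealOfVars [CommRing K] (j : σ) :
    X j ∈ Module.annihilator (MvPolynomial σ K) (MvPolynomial σ K ⧸ idealOfVars σ K) := by
  rw [Ideal.annihilator_quotient]
  exact Ideal.subset_span ⟨j, rfl⟩

/-- The quotient by `c` variables has no `Ext` with `K` below `n - c`. -/
lemma subsingleton_ext_quotient_span_X [CommRing K] [Fintype σ] (i : ℕ) (T : Finset σ)
    (h : i + T.card < Fintype.card σ) :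
    Subsingleton (Ext (ModuleCat.of (MvPolynomial σ K) (MvPolynomial σ K ⧸ idealOfVars σ K))
      (ModuleCat.of (MvPolynomial σ K)
        (MvPolynomial σ K ⧸ Ideal.span ((X : σ → MvPolynomial σ K) '' (T : Set σ)))) i) := by
  classical
  induction i using Nat.strong_induction_on generalizing T with
  | _ i ih =>
    obtain ⟨j, hj⟩ : ∃ j, j ∉ T := by
      by_contra! hT
      rw [Finset.eq_univ_iff_forall.2 hT, Finset.card_univ] at h
      omega
    refine subsingleton_ext_of_regular (X j)
      (P' := Ideal.span ((X : σ → MvPolynomial σ K) '' (insert j T : Finset σ)))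
      (fun f => mem_span_X_image_of_X_mul_mem hj)
      (by rw [Finset.coe_insert, Set.image_insert_eq, Ideal.span_insert]) _
      (X_mem_annihilator_quotient_idealOfVars j) i fun k hk => ih k (by omega) _ ?_
    rw [Finset.card_insert_of_notMem hj]
    omega

namespace CellPartition

variable {U : Set (σ →₀ ℕ)} {ι : Type} (c : CellPartition U ι)

/-- Multiples leave a cell only towards `U` or smaller rank, so absorbing cells in order of rank
always produces a monomial ideal. -/
lemma isUpperSet_union_cells (hU : IsUpperSet U) {F : Set ι}
    (hF : ∀ i ∈ F, ∀ j, c.rank j < c.rank i → j ∈ F) :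
    IsUpperSet (U ∪ ⋃ i ∈ F, monomialCell (c.a i) (c.Z i)) := by
  intro m m' h hm
  by_cases hm' : m' ∈ U
  · exact Or.inl hm'
  obtain ⟨j, hj⟩ := c.cover m' hm'
  rcases hm with hm | hm
  · exact Or.inl (hU h hm)
  · obtain ⟨i, hi, hmi⟩ := Set.mem_iUnion₂.1 hm
    refine Or.inr (Set.mem_iUnion₂.2 ⟨j, ?_, hj⟩)
    rcases c.rank_lt m m' i j hmi hj h with rfl | hlt
    exacts [hi, hF i hi j hlt]

/-- This computes the colon ideal at one step of the filtration. A multiple of the generator by a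
monomial in the variables of `c.Z i` stays in cell `i`, hence outside the ideal; any other multiple
falls into `U` or a cell of smaller rank, already absorbed. -/
lemma monomial_mul_mem_iff [CommRing K] (hU : IsUpperSet U) {F : Set ι}
    (hF : ∀ i ∈ F, ∀ j, c.rank j < c.rank i → j ∈ F) {i : ι} (hi : i ∉ F)
    (hrank : ∀ j, c.rank j < c.rank i → j ∈ F) (f : MvPolynomial σ K) :
    monomial (c.a i) (1 : K) * f ∈
        restrictSupportIdeal (R := K) _ (c.isUpperSet_union_cells hU hF) ↔
      f ∈ Ideal.span ((X : σ → MvPolynomial σ K) '' {j | j ∉ c.Z i}) := by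
  rw [monomial_mul_mem_restrictSupportIdeal, span_X_image_eq_restrictSupportIdeal,
    mem_restrictSupportIdeal]
  refine forall₂_congr fun m _ => ?_
  have hcell : m.support ⊆ c.Z i ↔ ¬ ∃ j ∈ {j | j ∉ c.Z i}, m j ≠ 0 := by
    simp only [Set.mem_ofPred_eq, not_exists, not_and, not_not, Finset.subset_iff,
      Finsupp.mem_support_iff]
    exact forall_congr' fun j => not_imp_comm
  constructor
  · intro hm
    by_contra hcon
    have hmem : c.a i + m ∈ monomialCell (c.a i) (c.Z i) := ⟨m, hcell.2 hcon, rfl⟩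
    rcases hm with hm | hm
    · exact c.notMem _ _ hmem hm
    · obtain ⟨j, hj, hmj⟩ := Set.mem_iUnion₂.1 hm
      exact hi (c.unique _ _ _ hmem hmj ▸ hj)
  · intro hm
    by_cases hmU : c.a i + m ∈ U
    · exact Or.inl hmU
    obtain ⟨j, hj⟩ := c.cover _ hmU
    have hai : c.a i ∈ monomialCell (c.a i) (c.Z i) := ⟨0, by simp, by simp⟩
    rcases c.rank_lt _ _ i j hai hj (le_self_add) with rfl | hlt
    · obtain ⟨b, hb, hbm⟩ := hj
      exact absurd hm (hcell.1 (add_left_cancel hbm ▸ hb))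
    · exact Or.inr (Set.mem_iUnion₂.2 ⟨j, hrank j hlt, hj⟩)

lemma restrictSupportIdeal_insert [CommRing K] (hU : IsUpperSet U) {F : Set ι}
    (hF : ∀ i ∈ F, ∀ j, c.rank j < c.rank i → j ∈ F) {i : ι}
    (hF' : ∀ k ∈ insert i F, ∀ j, c.rank j < c.rank k → j ∈ insert i F) :
    restrictSupportIdeal (R := K) _ (c.isUpperSet_union_cells hU hF') =
      Ideal.span {monomial (c.a i) (1 : K)} ⊔
        restrictSupportIdeal (R := K) _ (c.isUpperSet_union_cells hU hF) := by
  apply le_antisymm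
  · intro f hf
    rw [mem_restrictSupportIdeal] at hf
    rw [f.as_sum]
    refine Ideal.sum_mem _ fun m hm => ?_
    have hmon : monomial m (coeff m f) = C (coeff m f) * monomial m 1 := by
      rw [C_mul_monomial, mul_one]
    have key : ∀ V hV, m ∈ V → monomial m (coeff m f) ∈ restrictSupportIdeal (R := K) V hV := by
      intro V hV hmV
      rw [mem_restrictSupportIdeal]
      intro k hk
      rwa [Finset.mem_singleton.1 (support_monomial_subset hk)]
    rcases hf m hm with h | h
    · exact Ideal.mem_sup_right (key _ _ (Or.inl h))
    · obtain ⟨j, hj, hmj⟩ := Set.mem_iUnion₂.1 h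
      rcases hj with rfl | hj
      · obtain ⟨b, -, rfl⟩ := hmj
        refine Ideal.mem_sup_left (Ideal.mem_span_singleton'.2 ⟨monomial b (coeff (c.a j + b) f), ?_⟩)
        rw [monomial_mul, mul_one, add_comm]
      · exact Ideal.mem_sup_right (key _ _ (Or.inr (Set.mem_iUnion₂.2 ⟨j, hj, hmj⟩)))
  · refine sup_le ?_ ?_
    · rw [Ideal.span_singleton_le_iff_mem, mem_restrictSupportIdeal]
      intro k hk
      rw [Finset.mem_singleton.1 (support_monomial_subset hk)]
      exact Or.inr (Set.mem_iUnion₂.2 ⟨i, Set.mem_insert _ _, 0, by simp, by simp⟩)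
    · intro f hf
      rw [mem_restrictSupportIdeal] at hf ⊢
      intro m hm
      rcases hf m hm with h | h
      · exact Or.inl h
      · obtain ⟨j, hj, hmj⟩ := Set.mem_iUnion₂.1 h
        exact Or.inr (Set.mem_iUnion₂.2 ⟨j, Set.mem_insert_of_mem _ hj, hmj⟩)

/-- If the complement of `U` is partitioned into cells of dimension at least `d`, then the
`Ext^i` from `K` to the quotient by the monomial ideal given by `U` vanish for `i < d`. -/
theorem subsingleton_ext [CommRing K] [Fintype σ] [Fintype ι] (hU : IsUpperSet U) (d : ℕ)
    (hd : ∀ i, d ≤ (c.Z i).card) (k : ℕ) (hk : k < d) :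
    Subsingleton (Ext (ModuleCat.of (MvPolynomial σ K) (MvPolynomial σ K ⧸ idealOfVars σ K))
      (ModuleCat.of (MvPolynomial σ K)
        (MvPolynomial σ K ⧸ restrictSupportIdeal (R := K) U hU)) k) := by
  classical
  -- Induction on the number `q` of cells not yet absorbed. The set `V` is kept separate from its
  -- description because the ideal depends on a proof about it.
  suffices H : ∀ (q : ℕ) (F : Finset ι), (∀ i ∈ F, ∀ j, c.rank j < c.rank i → j ∈ F) →
      Fᶜ.card = q → ∀ V (hV : IsUpperSet V),
      V = U ∪ ⋃ i ∈ (F : Set ι), monomialCell (c.a i) (c.Z i) →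
      Subsingleton (Ext (ModuleCat.of (MvPolynomial σ K) (MvPolynomial σ K ⧸ idealOfVars σ K))
      (ModuleCat.of (MvPolynomial σ K) (MvPolynomial σ K ⧸
        restrictSupportIdeal (R := K) V hV)) k) from
    H _ ∅ (by simp) rfl U hU (by simp)
  intro q
  induction q with
  | zero =>
    rintro F - hq V hV rfl
    -- With all cells absorbed the ideal is the unit ideal and the quotient is zero.
    have hall : restrictSupportIdeal (R := K) _ hV = ⊤ := by
      rw [eq_top_iff]
      intro f _ m _
      by_cases hm : m ∈ U
      · exact Or.inl hm
      obtain ⟨j, hj⟩ := c.cover m hm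
      rw [Finset.card_eq_zero, Finset.compl_eq_empty_iff] at hq
      exact Or.inr (Set.mem_iUnion₂.2 ⟨j, by simp [hq], hj⟩)
    have hsub : Subsingleton (MvPolynomial σ K ⧸ restrictSupportIdeal (R := K) _ hV) :=
      Ideal.Quotient.subsingleton_iff.2 hall
    have := ModuleCat.isZero_of_subsingleton (ModuleCat.of (MvPolynomial σ K)
      (MvPolynomial σ K ⧸ restrictSupportIdeal (R := K) _ hV))
    refine subsingleton_of_forall_eq 0 fun y => ?_
    rw [← Ext.comp_mk₀_id y, (Limits.IsZero.iff_id_eq_zero _).1 this, Ext.mk₀_zero, Ext.comp_zero]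
  | succ q ih =>
    rintro F hF hq V hV rfl
    -- Absorbing a remaining cell of least rank keeps the absorbed family closed under passing to
    -- smaller rank.
    obtain ⟨i, hi, hmin⟩ := Finset.exists_min_image Fᶜ c.rank
      (Finset.card_pos.1 (by omega))
    rw [Finset.mem_compl] at hi
    have hrank : ∀ j, c.rank j < c.rank i → j ∈ (F : Set ι) := by
      intro j hj
      by_contra hjF
      exact absurd (hmin j (by simpa using hjF)) (by omega)
    have hF' : ∀ k ∈ insert i F, ∀ j, c.rank j < c.rank k → j ∈ insert i F := by
      intro k hk j hj
      rw [Finset.mem_insert] at hk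
      rcases hk with rfl | hk
      exacts [Finset.mem_insert_of_mem (hrank j hj), Finset.mem_insert_of_mem (hF k hk j hj)]
    have hF'' : ∀ k ∈ insert i (F : Set ι), ∀ j, c.rank j < c.rank k → j ∈ insert i (F : Set ι) := by
      simpa only [← Finset.coe_insert, Finset.mem_coe] using hF'
    have h₃ := ih (insert i F) hF' (by
      have := Finset.card_compl_add_card F
      have := Finset.card_compl_add_card (insert i F)
      rw [Finset.card_insert_of_notMem hi] at this
      omega) _ (c.isUpperSet_union_cells hU hF'') (by rw [Finset.coe_insert])
    have hP := c.monomial_mul_mem_iff (K := K) hU (F := F) hF hi hrank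
    have hI := c.restrictSupportIdeal_insert (K := K) hU (F := F) hF (i := i) hF''
    have h₁ := subsingleton_ext_quotient_span_X (K := K) k (c.Z i)ᶜ (by
      have := Finset.card_compl_add_card (c.Z i)
      have := hd i
      omega)
    have hset : (((c.Z i)ᶜ : Finset σ) : Set σ) = {j | j ∉ c.Z i} := by ext; simp
    rw [hset] at h₁
    exact subsingleton_ext_of_shortExact (colonShortComplex_shortExact _ (fun f => (hP f).2)
      (fun f => (hP f).1) hI) _ k h₁ h₃

end CellPartition

end MonomialIdeal

/-! ### Stanley decompositions from cells, and the upper bound for Stanley depth -/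

section StanleyDepth

open MvPolynomial

variable {K : Type u} {n : ℕ}

lemma linearIndependent_mk_monomial [CommRing K] {U : Set (Fin n →₀ ℕ)} (hU : IsUpperSet U) :
    LinearIndependent K (fun m : {m // m ∉ U} =>
      Ideal.Quotient.mk (restrictSupportIdeal (R := K) U hU) (monomial m.1 (1 : K))) := by
  rw [linearIndependent_iff']
  intro s g hg i hi
  have hmem : ∑ j ∈ s, monomial j.1 (g j) ∈ restrictSupportIdeal (R := K) U hU := by
    rw [← Ideal.Quotient.eq_zero_iff_mem, map_sum, ← hg]
    refine Finset.sum_congr rfl fun j _ => ?_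
    rw [← Ideal.Quotient.mkₐ_eq_mk K, ← map_smul, smul_monomial, smul_eq_mul, mul_one]
  by_contra hne
  refine i.2 (mem_restrictSupportIdeal.1 hmem i.1 ?_)
  rw [mem_support_iff, coeff_sum, Finset.sum_eq_single i]
  · simpa using hne
  · intro j _ hj
    rw [coeff_monomial, if_neg fun h => hj (Subtype.ext h)]
  · exact fun h => absurd hi h

lemma monomial_smul_mk_monomial [CommRing K] (I : Ideal (MvPolynomial (Fin n) K))
    (a b : Fin n →₀ ℕ) :
    monomial b (1 : K) • Ideal.Quotient.mk I (monomial a (1 : K)) =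
      Ideal.Quotient.mk I (monomial (a + b) (1 : K)) := by
  change Ideal.Quotient.mk I (monomial b 1 * monomial a 1) = _
  rw [monomial_mul, one_mul, add_comm]

lemma span_mk_monomial_eq_top [CommRing K] {U : Set (Fin n →₀ ℕ)} (hU : IsUpperSet U) :
    Submodule.span K (Set.range fun m : {m // m ∉ U} =>
      Ideal.Quotient.mk (restrictSupportIdeal (R := K) U hU) (monomial m.1 (1 : K))) = ⊤ := by
  rw [eq_top_iff]
  rintro y -
  obtain ⟨f, rfl⟩ := Ideal.Quotient.mk_surjective y
  rw [f.as_sum, map_sum]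
  refine Submodule.sum_mem _ fun m _ => ?_
  by_cases hm : m ∈ U
  · rw [Ideal.Quotient.eq_zero_iff_mem.2]
    · exact zero_mem _
    · rw [mem_restrictSupportIdeal]
      intro k hk
      rwa [Finset.mem_singleton.1 (support_monomial_subset hk)]
  · have : monomial m (coeff m f) = coeff m f • monomial m (1 : K) := by
      rw [smul_monomial, smul_eq_mul, mul_one]
    rw [this, ← Ideal.Quotient.mkₐ_eq_mk K, map_smul]
    exact Submodule.smul_mem _ _ (Submodule.subset_span ⟨⟨m, hm⟩, rfl⟩)

namespace CellPartition

variable {U : Set (Fin n →₀ ℕ)} {ι : Type} (c : CellPartition U ι)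

lemma stanleySpan_eq [CommRing K] (hU : IsUpperSet U) (i : ι) :
    stanleySpan K (Ideal.Quotient.mk (restrictSupportIdeal (R := K) U hU)
        (monomial (c.a i) (1 : K))) (c.Z i) =
      Submodule.span K ((fun m : {m // m ∉ U} =>
        Ideal.Quotient.mk (restrictSupportIdeal (R := K) U hU) (monomial m.1 (1 : K))) ''
          {m | m.1 ∈ monomialCell (c.a i) (c.Z i)}) := by
  unfold stanleySpan
  congr 1
  ext w
  constructor
  · rintro ⟨b, hb, rfl⟩
    have hmem : c.a i + b ∈ monomialCell (c.a i) (c.Z i) := ⟨b, hb, rfl⟩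
    exact ⟨⟨_, c.notMem _ _ hmem⟩, hmem, (monomial_smul_mk_monomial _ _ _).symm⟩
  · rintro ⟨⟨_, hm⟩, ⟨b, hb, rfl⟩, rfl⟩
    exact ⟨b, hb, (monomial_smul_mk_monomial _ _ _).symm⟩

lemma isInternal_stanleySpan [CommRing K] [DecidableEq ι] (hU : IsUpperSet U) :
    DirectSum.IsInternal fun i =>
      stanleySpan K (Ideal.Quotient.mk (restrictSupportIdeal (R := K) U hU)
        (monomial (c.a i) (1 : K))) (c.Z i) := by
  apply DirectSum.isInternal_submodule_of_iSupIndep_of_iSup_eq_top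
  · intro i
    have hle : (⨆ j, ⨆ (_ : j ≠ i), stanleySpan K (Ideal.Quotient.mk
        (restrictSupportIdeal (R := K) U hU) (monomial (c.a j) (1 : K))) (c.Z j)) ≤
        Submodule.span K ((fun m : {m // m ∉ U} =>
          Ideal.Quotient.mk (restrictSupportIdeal (R := K) U hU) (monomial m.1 (1 : K))) ''
            {m | m.1 ∉ monomialCell (c.a i) (c.Z i)}) := by
      refine iSup₂_le fun j hj => ?_
      rw [c.stanleySpan_eq hU]
      exact Submodule.span_mono (Set.image_mono fun m hm hm' => hj (c.unique _ _ _ hm hm'))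
    refine Disjoint.mono_right hle ?_
    beta_reduce
    rw [c.stanleySpan_eq hU]
    exact (linearIndependent_mk_monomial hU).disjoint_span_image
      (Set.disjoint_left.2 fun m hm hm' => hm' hm)
  · rw [eq_top_iff, ← span_mk_monomial_eq_top hU, Submodule.span_le]
    rintro _ ⟨m, rfl⟩
    obtain ⟨i, hi⟩ := c.cover m.1 m.2
    refine Submodule.mem_iSup_of_mem i ?_
    rw [c.stanleySpan_eq hU]
    exact Submodule.subset_span ⟨m, hi, rfl⟩

/-- The Stanley decomposition of the quotient by a monomial ideal which is given by a partition
into cells. -/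
noncomputable def stanleyDecomposition [CommRing K] [Fintype ι] (hU : IsUpperSet U) :
    StanleyDecomposition K (quotientGrading (restrictSupportIdeal (R := K) U hU)) where
  r := Fintype.card ι
  u k := Ideal.Quotient.mk _ (monomial (c.a ((Fintype.equivFin ι).symm k)) (1 : K))
  Z k := c.Z ((Fintype.equivFin ι).symm k)
  homogeneous k := ⟨fun j => (c.a ((Fintype.equivFin ι).symm k) j : ℤ),
    Submodule.subset_span ⟨_, fun _ => rfl, rfl⟩⟩
  free k p hp h := by
    change Ideal.Quotient.mk _ (p * monomial _ 1) = 0 at h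
    rw [Ideal.Quotient.eq_zero_iff_mem, mul_comm, monomial_mul_mem_restrictSupportIdeal] at h
    rw [← support_eq_empty, Finset.eq_empty_iff_forall_notMem]
    intro m hm
    -- If p kills the generator, each monomial of p moves the generator into `U`; but the variables
    -- of p lie in Z, so it also stays in its cell.
    refine c.notMem _ _ ⟨m, fun j hj => ?_, rfl⟩ (h m hm)
    exact Finset.mem_coe.1 (mem_supported.1 hp ((mem_vars_iff_mem_support j).2 ⟨m, hm, hj⟩))
  isInternal := by
    classical
    let e := (Fintype.equivFin ι).symm
    -- The partition is renumbered by `Fin`, as Stanley decompositions are indexed.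
    exact ({ a := fun k => c.a (e k)
             Z := fun k => c.Z (e k)
             rank := fun k => c.rank (e k)
             cover := fun m hm => (c.cover m hm).imp' (Fintype.equivFin ι) fun i hi => by
               simpa [e] using hi
             unique := fun m i j hi hj => e.injective (c.unique m _ _ hi hj)
             notMem := fun m i => c.notMem m _
             rank_lt := fun m m' i j hi hj h =>
               (c.rank_lt m m' _ _ hi hj h).imp (fun h => e.injective h) id } :
      CellPartition U (Fin (Fintype.card ι))).isInternal_stanleySpan hU

theorem le_sdepthQuotient [CommRing K] [Fintype ι] (hU : IsUpperSet U) (d : ℕ)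
    (hd : ∀ i, d ≤ (c.Z i).card) :
    (d : ℕ∞) ≤ sdepthQuotient (restrictSupportIdeal (R := K) U hU) :=
  le_iSup_of_le (c.stanleyDecomposition hU) (le_iInf fun _ => Nat.cast_le.2 (hd _))

theorem le_depthQuotient [CommRing K] [Fintype ι] (hU : IsUpperSet U) (d : ℕ)
    (hd : ∀ i, d ≤ (c.Z i).card) :
    (d : ℕ∞) ≤ depthQuotient (restrictSupportIdeal (R := K) U hU) := by
  refine le_iInf₂ fun k hk => Nat.cast_le.2 ?_
  by_contra! hlt
  exact not_subsingleton_iff_nontrivial.2 hk (c.subsingleton_ext hU d hd k hlt)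

end CellPartition

lemma exists_eq_smul_of_mem_quotientGrading [CommRing K] {I : Ideal (MvPolynomial (Fin n) K)}
    {a : Fin n → ℤ} {y : MvPolynomial (Fin n) K ⧸ I} (hy : y ∈ quotientGrading I a) (hy0 : y ≠ 0) :
    ∃ (r : K) (b : Fin n →₀ ℕ), y = r • Ideal.Quotient.mk I (monomial b (1 : K)) := by
  by_cases ha : ∃ b : Fin n →₀ ℕ, ∀ i, (b i : ℤ) = a i
  · obtain ⟨b, hb⟩ := ha
    have hle : quotientGrading I a ≤ Submodule.span K {Ideal.Quotient.mk I (monomial b (1 : K))} := by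
      refine Submodule.span_mono ?_
      rintro w ⟨b', hb', rfl⟩
      obtain rfl : b' = b := Finsupp.ext fun i => by exact_mod_cast (hb' i).trans (hb i).symm
      rfl
    obtain ⟨r, rfl⟩ := Submodule.mem_span_singleton.1 (hle hy)
    exact ⟨r, b, rfl⟩
  · have hbot : quotientGrading I a = ⊥ := by
      rw [quotientGrading, Submodule.span_eq_bot]
      rintro w ⟨b, hb, -⟩
      exact absurd ⟨b, hb⟩ ha
    rw [hbot, Submodule.mem_bot] at hy
    exact absurd hy hy0

theorem sdepthQuotient_le [Field K] {U : Set (Fin n →₀ ℕ)} (hU : IsUpperSet U) (h0 : 0 ∉ U) (d : ℕ)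
    (hd : ∀ m, m ∉ U → m.support.card ≤ d) :
    sdepthQuotient (restrictSupportIdeal (R := K) U hU) ≤ d := by
  refine iSup_le fun D => ?_
  have hnt : Nontrivial (MvPolynomial (Fin n) K ⧸ restrictSupportIdeal (R := K) U hU) := by
    rw [Ideal.Quotient.nontrivial_iff, Ideal.ne_top_iff_one]
    exact fun h => h0 (monomial_mem_restrictSupportIdeal.1 h)
  -- An empty decomposition would have depth `⊤`, so the quotient must be nonzero.
  obtain ⟨i⟩ : Nonempty (Fin D.r) := by
    by_contra hempty
    rw [not_nonempty_iff] at hempty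
    have := D.isInternal.submodule_iSup_eq_top
    rw [iSup_of_empty] at this
    exact bot_ne_top this
  refine iInf_le_of_le i (Nat.cast_le.2 ?_)
  have hui : D.u i ≠ 0 := by
    intro h
    exact one_ne_zero (D.free i 1 (one_mem _) (by rw [h, smul_zero]))
  obtain ⟨a, ha⟩ := D.homogeneous i
  obtain ⟨r, b, hb⟩ := exists_eq_smul_of_mem_quotientGrading ha hui
  -- The exponent of the product of all variables in `D.Z i`; freeness keeps its multiple of the
  -- generator nonzero.
  set e : Fin n →₀ ℕ := Finsupp.indicator (D.Z i) fun _ _ => 1 with he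
  have hesupp : D.Z i ⊆ e.support := by
    intro j hj
    rw [Finsupp.mem_support_iff, he, Finsupp.indicator_of_mem hj]
    exact one_ne_zero
  have hmem : b + e ∉ U := by
    intro hbe
    have hp : monomial e (1 : K) ∈ supported K (D.Z i : Set (Fin n)) := by
      rw [mem_supported, vars_monomial one_ne_zero]
      exact Finset.coe_subset.2 (Finsupp.support_indicator_subset _ _)
    have h := D.free i _ hp (by
      rw [hb, smul_comm, monomial_smul_mk_monomial, Ideal.Quotient.eq_zero_iff_mem.2
        (monomial_mem_restrictSupportIdeal.2 hbe), smul_zero])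
    rw [monomial_eq_zero] at h
    exact one_ne_zero h
  refine (Finset.card_le_card fun j hj => ?_).trans (hd _ hmem)
  have := Finsupp.mem_support_iff.1 (hesupp hj)
  rw [Finsupp.mem_support_iff, Finsupp.add_apply]
  omega

end StanleyDepth

/-! ### Depth is at most Krull dimension -/

section DepthUpperBound

open MvPolynomial Abelian RingTheory.Sequence

/-- A nonzerodivisor avoids the minimal primes of the support, so each term of the sequence lowers
the dimension by at least one; the last quotient is nonzero, so its dimension is at least 0. -/
lemma length_le_supportDim_of_isRegular {R : Type*} [CommRing R] {M : Type*}
    [AddCommGroup M] [Module R M] [Module.Finite R M] (rs : List R)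
    (h : IsRegular M rs) : (rs.length : WithBot ℕ∞) ≤ Module.supportDim R M := by
  induction rs generalizing M with
  | nil =>
    have : Nontrivial M := by
      by_contra hM
      rw [not_nontrivial_iff_subsingleton] at hM
      exact h.2 (Subsingleton.elim _ _)
    have : Nonempty (Module.support R M) := Module.nonempty_support_of_nontrivial.to_subtype
    rw [List.length_nil, Nat.cast_zero]
    exact Order.krullDim_nonneg
  | cons x rs ih =>
    rw [isRegular_cons_iff] at h
    rw [List.length_cons, Nat.cast_succ]
    exact (add_le_add_left (ih h.2) 1).trans
      (Module.supportDim_quotSMulTop_succ_le_of_notMem_minimalPrimes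
        fun _ => h.1.notMem_of_mem_minimalPrimes)

variable {K : Type u} {σ : Type}

lemma ringKrullDim_quotient_span_X_add_card_le [Field K] [Finite σ] (T : Finset σ) :
    ringKrullDim (MvPolynomial σ K ⧸ Ideal.span ((X : σ → MvPolynomial σ K) '' (T : Set σ))) +
      T.card ≤ Nat.card σ := by
  classical
  induction T using Finset.induction_on with
  | empty =>
    rw [Finset.card_empty, Nat.cast_zero, add_zero]
    refine (ringKrullDim_quotient_le _).trans ?_
    rw [ringKrullDim_of_isNoetherianRing, ringKrullDim_eq_zero_of_field, zero_add]
  | insert j T hj ih =>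
    refine le_trans ?_ ih
    rw [Finset.card_insert_of_notMem hj, Nat.cast_succ, add_comm (T.card : WithBot ℕ∞), ← add_assoc]
    refine add_le_add_left ?_ _
    have hle : Ideal.span ((X : σ → MvPolynomial σ K) '' (T : Set σ)) ≤
        Ideal.span ((X : σ → MvPolynomial σ K) '' ((insert j T : Finset σ) : Set σ)) :=
      Ideal.span_mono (Set.image_mono (Finset.coe_subset.2 (Finset.subset_insert _ _)))
    refine ringKrullDim_succ_le_of_surjective (Ideal.Quotient.factor hle)
      (Ideal.Quotient.factor_surjective hle) (r := Ideal.Quotient.mk _ (X j)) ?_ ?_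
    · rw [mem_nonZeroDivisors_iff_right]
      intro y hy
      obtain ⟨f, rfl⟩ := Ideal.Quotient.mk_surjective y
      rw [← map_mul, Ideal.Quotient.eq_zero_iff_mem, mul_comm] at hy
      exact Ideal.Quotient.eq_zero_iff_mem.2 (mem_span_X_image_of_X_mul_mem hj hy)
    · rw [Ideal.Quotient.factor_mk, Ideal.Quotient.eq_zero_iff_mem]
      exact Ideal.subset_span ⟨j, by simp, rfl⟩

/-- Let q be the bottom of a chain of primes over the ideal and T the set of variables in q. The
product of the other variables is not in q, hence not in the ideal, so there are at most `d` of
them. The chain lies over the ideal of the variables in T, which bounds its length. -/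
lemma ringKrullDim_quotient_restrictSupportIdeal_le [Field K] [Fintype σ] {U : Set (σ →₀ ℕ)}
    (hU : IsUpperSet U) (d : ℕ) (hd : ∀ m, m ∉ U → m.support.card ≤ d) :
    ringKrullDim (MvPolynomial σ K ⧸ restrictSupportIdeal (R := K) U hU) ≤ d := by
  classical
  rw [ringKrullDim_quotient]
  refine iSup_le fun p => ?_
  set q := p.head.1 with hq
  set T : Finset σ := Finset.univ.filter fun j => X j ∈ q.asIdeal with hT
  have hTq : Ideal.span ((X : σ → MvPolynomial σ K) '' (T : Set σ)) ≤ q.asIdeal := by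
    rw [Ideal.span_le]
    rintro _ ⟨j, hj, rfl⟩
    exact (Finset.mem_filter.1 hj).2
  have hcard : Tᶜ.card ≤ d := by
    set e : σ →₀ ℕ := Finsupp.indicator Tᶜ fun _ _ => 1 with he
    have hesupp : Tᶜ ⊆ e.support := by
      intro j hj
      rw [Finsupp.mem_support_iff, he, Finsupp.indicator_of_mem hj]
      exact one_ne_zero
    refine (Finset.card_le_card hesupp).trans (hd e fun heU => ?_)
    have hmem : monomial e (1 : K) ∈ q.asIdeal :=
      p.head.2 (monomial_mem_restrictSupportIdeal.2 heU)
    rw [monomial_eq, C_1, one_mul, Finsupp.prod, q.isPrime.prod_mem_iff] at hmem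
    obtain ⟨j, hj, hjq⟩ := hmem
    have hjT : j ∈ Tᶜ := Finsupp.support_indicator_subset _ _ hj
    rw [hT, Finset.mem_compl, Finset.mem_filter] at hjT
    exact hjT ⟨Finset.mem_univ _, q.isPrime.mem_of_pow_mem _ hjq⟩
  let p' : LTSeries (PrimeSpectrum.zeroLocus (R := MvPolynomial σ K)
      (Ideal.span ((X : σ → MvPolynomial σ K) '' (T : Set σ)))) :=
    { length := p.length
      toFun := fun k => ⟨(p k).1, hTq.trans (p.head_le k)⟩
      step := fun k => p.step k }
  have hlen := le_iSup (fun p : LTSeries _ => (p.length : WithBot ℕ∞)) p'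
  change (p.length : WithBot ℕ∞) ≤ Order.krullDim _ at hlen
  rw [← ringKrullDim_quotient] at hlen
  have h := (add_le_add_left hlen (T.card : WithBot ℕ∞)).trans
    (ringKrullDim_quotient_span_X_add_card_le T)
  have h' : p.length + T.card ≤ Nat.card σ := by exact_mod_cast h
  have := Finset.card_compl_add_card T
  rw [Nat.card_eq_fintype_card] at h'
  exact_mod_cast (by omega : p.length ≤ d)

lemma one_notMem_idealOfVars [Field K] : (1 : MvPolynomial σ K) ∉ idealOfVars σ K := by
  rw [idealOfVars, ← Set.image_univ, span_X_image_eq_restrictSupportIdeal]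
  intro h
  obtain ⟨i, -, hi⟩ := (monomial_mem_restrictSupportIdeal (m := 0)).1 h
  exact hi rfl

lemma restrictSupportIdeal_le_idealOfVars [Field K] {U : Set (σ →₀ ℕ)} (hU : IsUpperSet U)
    (h0 : 0 ∉ U) : restrictSupportIdeal (R := K) U hU ≤ idealOfVars σ K := by
  rw [idealOfVars, ← Set.image_univ, span_X_image_eq_restrictSupportIdeal]
  intro f hf
  rw [mem_restrictSupportIdeal] at hf ⊢
  intro m hm
  have hm0 : m ≠ 0 := by
    rintro rfl
    exact h0 (hf _ hm)
  obtain ⟨i, hi⟩ := DFunLike.ne_iff.1 hm0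
  exact ⟨i, Set.mem_univ _, hi⟩

theorem depthQuotient_le [Field K] {n : ℕ} {U : Set (Fin n →₀ ℕ)} (hU : IsUpperSet U) (h0 : 0 ∉ U)
    (d : ℕ) (hd : ∀ m, m ∉ U → m.support.card ≤ d) :
    depthQuotient (restrictSupportIdeal (R := K) U hU) ≤ d := by
  by_contra! hlt
  set I := restrictSupportIdeal (R := K) U hU with hI
  have hext : ∀ i < d + 1, Subsingleton (Ext
      (ModuleCat.of (MvPolynomial (Fin n) K) (MvPolynomial (Fin n) K ⧸ idealOfVars (Fin n) K))
      (ModuleCat.of (MvPolynomial (Fin n) K) (MvPolynomial (Fin n) K ⧸ I)) i) := by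
    intro i hi
    by_contra hnt
    rw [not_subsingleton_iff_nontrivial] at hnt
    exact absurd ((iInf₂_le i hnt).trans (Nat.cast_le.2 (Nat.lt_succ_iff.1 hi))) hlt.not_ge
  have hlt : idealOfVars (Fin n) K • (⊤ : Submodule (MvPolynomial (Fin n) K)
      (MvPolynomial (Fin n) K ⧸ I)) < ⊤ := by
    rw [lt_top_iff_ne_top]
    intro htop
    -- The surjection from S/I to S/𝔪 kills 𝔪(S/I) but not the class of 1.
    have hle : idealOfVars (Fin n) K • (⊤ : Submodule (MvPolynomial (Fin n) K)
        (MvPolynomial (Fin n) K ⧸ I)) ≤ LinearMap.ker (Submodule.mapQ I (idealOfVars (Fin n) K)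
          LinearMap.id (restrictSupportIdeal_le_idealOfVars hU h0)) := by
      rw [Submodule.smul_le]
      intro r hr y _
      obtain ⟨f, rfl⟩ := Submodule.Quotient.mk_surjective _ y
      change Submodule.Quotient.mk (r * f) = 0
      rw [Submodule.Quotient.mk_eq_zero]
      exact Ideal.mul_mem_right _ _ hr
    have h1 : Submodule.Quotient.mk (p := I) 1 ∈ LinearMap.ker (Submodule.mapQ I
        (idealOfVars (Fin n) K) LinearMap.id (restrictSupportIdeal_le_idealOfVars hU h0)) :=
      hle (by rw [htop]; exact Submodule.mem_top)
    change Submodule.Quotient.mk 1 = 0 at h1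
    rw [Submodule.Quotient.mk_eq_zero] at h1
    exact one_notMem_idealOfVars h1
  obtain ⟨rs, hlen, -, hreg⟩ := ModuleCat.exists_isRegular_of_exists_subsingleton_ext
    (idealOfVars (Fin n) K) (d + 1)
    (ModuleCat.of (MvPolynomial (Fin n) K) (MvPolynomial (Fin n) K ⧸ I)) hlt
    (ModuleCat.of (MvPolynomial (Fin n) K) (MvPolynomial (Fin n) K ⧸ idealOfVars (Fin n) K))
    (by
      change Module.support _ (MvPolynomial (Fin n) K ⧸ idealOfVars (Fin n) K) = _
      rw [Module.support_eq_zeroLocus, Ideal.annihilator_quotient]) hext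
  have h := (length_le_supportDim_of_isRegular rs hreg).trans
    ((Module.supportDim_quotient_eq_ringKrullDim I).le.trans
      (ringKrullDim_quotient_restrictSupportIdeal_le hU d hd))
  rw [hlen] at h
  exact absurd (Nat.cast_le.1 (by exact_mod_cast h : ((d + 1 : ℕ) : ℕ∞) ≤ (d : ℕ∞))) (by omega)

end DepthUpperBound

/-! ### The partition into cells of dimension d - 1 and d -/

section SkeletonPartition

/-- Erase the minimum until `k` elements remain. This supplies the last missing variables of a
monomial. -/
lemma Finset.exists_upper_subset_card_eq {α : Type*} [LinearOrder α] (s : Finset α) (k : ℕ)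
    (h : k ≤ s.card) :
    ∃ t ⊆ s, t.card = k ∧ ∀ z ∈ s, ∀ x ∈ t, x ≤ z → z ∈ t := by
  induction s using Finset.strongInduction with
  | _ s ih =>
    rcases h.eq_or_lt with rfl | hlt
    · exact ⟨s, subset_rfl, rfl, fun z hz _ _ _ => hz⟩
    · have hne : s.Nonempty := Finset.card_pos.1 (by omega)
      have hmin := s.min'_mem hne
      obtain ⟨t, hts, htk, ht⟩ := ih (s.erase (s.min' hne)) (Finset.erase_ssubset hmin)
        (by rw [Finset.card_erase_of_mem hmin]; omega)
      refine ⟨t, hts.trans (Finset.erase_subset _ _), htk, fun z hz x hx hxz => ?_⟩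
      refine ht z (Finset.mem_erase.2 ⟨?_, hz⟩) x hx hxz
      rintro rfl
      obtain ⟨hx1, hx2⟩ := Finset.mem_erase.1 (hts hx)
      exact hx1 (le_antisymm hxz (s.min'_le x hx2))

/-- If `t` absorbs all elements of `t'` above one of its own, and `t' ≠ t` has the same size, then
some element of `t'` lies below all of `t`. -/
lemma Finset.exists_forall_lt_of_upper {α : Type*} [LinearOrder α] {t t' : Finset α}
    (hcard : t'.card = t.card) (h : ∀ z ∈ t', ∀ x ∈ t, x ≤ z → z ∈ t) (hne : t' ≠ t) :
    ∃ z ∈ t', ∀ x ∈ t, z < x := by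
  obtain ⟨z, hz, hzt⟩ := Finset.not_subset.1 fun hsub =>
    hne (Finset.eq_of_subset_of_card_le hsub hcard.ge)
  exact ⟨z, hz, fun x hx => lt_of_not_ge fun hxz => hzt (h z hz x hx hxz)⟩

variable {n : ℕ}

/-- The set of variables that do not occur in a monomial. -/
def zeroSet (m : Fin n →₀ ℕ) : Finset (Fin n) := m.supportᶜ

lemma mem_zeroSet {m : Fin n →₀ ℕ} {j : Fin n} : j ∈ zeroSet m ↔ m j = 0 := by
  simp [zeroSet]

lemma zeroSet_anti {m m' : Fin n →₀ ℕ} (h : m ≤ m') : zeroSet m' ⊆ zeroSet m := fun j hj =>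
  mem_zeroSet.2 (Nat.le_zero.1 ((h j).trans_eq (mem_zeroSet.1 hj)))

/-- The exponents of the monomials divisible by `∏_{i ∈ A} x_i` for some `A ∈ 𝒜`. -/
def squarefreeSet (𝒜 : Set (Finset (Fin n))) : Set (Fin n →₀ ℕ) := {m | ∃ A ∈ 𝒜, A ⊆ m.support}

lemma isUpperSet_squarefreeSet (𝒜 : Set (Finset (Fin n))) : IsUpperSet (squarefreeSet 𝒜) := by
  rintro m m' h ⟨A, hA, hAm⟩
  refine ⟨A, hA, fun j hj => ?_⟩
  have := h j
  have := Finsupp.mem_support_iff.1 (hAm hj)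
  rw [Finsupp.mem_support_iff]
  omega

/-- The index set of the cells: for `n - d + 1` variables the cell of the monomials for which these
are the last `n - d + 1` missing variables; and for `n - d` variables whose complement is not a
generator the cell of the monomials for which these are all the missing variables. -/
abbrev CellIndex (𝒜 : Set (Finset (Fin n))) (d : ℕ) : Type :=
  {T : Finset (Fin n) // T.card + d = n + 1 ∨ (T.card + d = n ∧ Tᶜ ∉ 𝒜)}

/-- The exponent of the generator of the cell of `T`. -/
noncomputable def cellGenerator (d : ℕ) (T : Finset (Fin n)) : Fin n →₀ ℕ :=
  Finsupp.indicator (Finset.univ.filter fun j => j ∉ T ∧ (T.card + d = n ∨ ∃ t ∈ T, t ≤ j))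
    fun _ _ => 1

/-- The generator contains exactly the variables that must occur for no further missing variable to
be allowed: those outside `T` above its minimum, or all those outside `T` when `T` is to be the
whole missing set. -/
lemma mem_monomialCell_cellGenerator {d : ℕ} {T : Finset (Fin n)} {m : Fin n →₀ ℕ} :
    m ∈ monomialCell (cellGenerator d T) Tᶜ ↔
      T ⊆ zeroSet m ∧ ∀ z ∈ zeroSet m, (T.card + d = n ∨ ∃ t ∈ T, t ≤ z) → z ∈ T := by
  have hgen : ∀ j, cellGenerator d T j =
      if j ∉ T ∧ (T.card + d = n ∨ ∃ t ∈ T, t ≤ j) then 1 else 0 := by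
    intro j
    simp [cellGenerator, Finsupp.indicator_apply]
  constructor
  · rintro ⟨b, hb, rfl⟩
    refine ⟨fun j hj => ?_, fun z hz h => ?_⟩
    · rw [mem_zeroSet, Finsupp.add_apply, hgen, if_neg fun h => h.1 hj, zero_add]
      by_contra hbj
      exact Finset.mem_compl.1 (hb (Finsupp.mem_support_iff.2 hbj)) hj
    · by_contra hzT
      rw [mem_zeroSet, Finsupp.add_apply, hgen, if_pos ⟨hzT, h⟩] at hz
      omega
  · rintro ⟨hT, hm⟩
    refine ⟨m - cellGenerator d T, fun j hj => ?_, (add_tsub_cancel_of_le fun j => ?_).symm⟩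
    · rw [Finset.mem_compl]
      intro hjT
      rw [Finsupp.mem_support_iff, Finsupp.tsub_apply, mem_zeroSet.1 (hT hjT)] at hj
      omega
    · rw [hgen]
      split_ifs with h
      · by_contra hmj
        exact h.1 (hm j (mem_zeroSet.2 (by omega)) h.2)
      · exact Nat.zero_le _

/-- The position of a cell in the order in which the cells are removed. -/
noncomputable def cellRank (d : ℕ) (T : Finset (Fin n)) : ℕ :=
  if T.card + d = n then 0 else 1 + (Finset.univ.filter fun j => ∀ t ∈ T, j < t).card

/-- Passing to a multiple shrinks the set of missing variables, so the last ones can only move down,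
which leaves fewer indices below all of them. The summand 1 in the rank of these cells puts the
cells of full dimension, of rank 0, strictly first. -/
lemma eq_or_cellRank_lt {d : ℕ} {T T' : Finset (Fin n)} {m m' : Fin n →₀ ℕ}
    (hT : T.card + d = n + 1 ∨ T.card + d = n) (hT' : T'.card + d = n + 1 ∨ T'.card + d = n)
    (hm : m ∈ monomialCell (cellGenerator d T) Tᶜ)
    (hm' : m' ∈ monomialCell (cellGenerator d T') T'ᶜ) (h : m ≤ m') :
    T' = T ∨ cellRank d T' < cellRank d T := by
  rw [mem_monomialCell_cellGenerator] at hm hm'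
  have hsub : T' ⊆ zeroSet m := hm'.1.trans (zeroSet_anti h)
  rcases hT with hT | hT
  · unfold cellRank
    rw [if_neg (show ¬ T.card + d = n by omega)]
    rcases hT' with hT' | hT'
    · rw [if_neg (show ¬ T'.card + d = n by omega), or_iff_not_imp_left]
      intro hne
      obtain ⟨z, hz, hzT⟩ := Finset.exists_forall_lt_of_upper (t := T) (t' := T') (by omega)
        (fun z hz x hx hxz => hm.2 z (hsub hz) (Or.inr ⟨x, hx, hxz⟩)) hne
      refine Nat.add_lt_add_left (Finset.card_lt_card ?_) 1
      rw [Finset.ssubset_iff_of_subset]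
      · exact ⟨z, by simpa using hzT, fun hz' => lt_irrefl z ((Finset.mem_filter.1 hz').2 z hz)⟩
      · intro j hj
        rw [Finset.mem_filter] at hj ⊢
        exact ⟨hj.1, fun t ht => (hj.2 z hz).trans (hzT t ht)⟩
    · rw [if_pos hT']
      exact Or.inr (by omega)
  -- Here T is the whole missing set of m, of the least size allowed for T', so T' ⊆ T forces
  -- equality.
  · have hTz : zeroSet m ⊆ T := fun z hz => hm.2 z hz (Or.inl hT)
    exact Or.inl (Finset.eq_of_subset_of_card_le (hsub.trans hTz) (by omega))

/-- The partition of the monomials outside a squarefree monomial ideal, generated in degree `d` and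
containing all squarefree monomials of degree `d + 1`. -/
noncomputable def skeletonPartition (𝒜 : Set (Finset (Fin n))) (d : ℕ) (hd : d ≤ n)
    (h₁ : ∀ A ∈ 𝒜, A.card = d) (h₂ : ∀ B : Finset (Fin n), d < B.card → ∃ A ∈ 𝒜, A ⊆ B) :
    CellPartition (squarefreeSet 𝒜) (CellIndex 𝒜 d) where
  a T := cellGenerator d T.1
  Z T := T.1ᶜ
  rank T := cellRank d T.1
  cover m hm := by
    have hcard := Finset.card_compl_add_card m.support
    rw [Fintype.card_fin] at hcard
    have hle : m.support.card ≤ d := by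
      by_contra! hlt
      exact hm (h₂ _ hlt)
    rcases hle.eq_or_lt with heq | hlt
    · refine ⟨⟨zeroSet m, Or.inr ⟨by unfold zeroSet; omega, fun hA => hm ⟨_, hA, ?_⟩⟩⟩,
        mem_monomialCell_cellGenerator.2 ⟨subset_rfl, fun z hz _ => hz⟩⟩
      rw [zeroSet, compl_compl]
    · obtain ⟨T, hT, hTc, hup⟩ := (zeroSet m).exists_upper_subset_card_eq (n + 1 - d)
        (by unfold zeroSet; omega)
      refine ⟨⟨T, Or.inl (by omega)⟩, mem_monomialCell_cellGenerator.2 ⟨hT, fun z hz h => ?_⟩⟩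
      obtain ⟨t, ht, htz⟩ := h.resolve_left (show ¬ T.card + d = n by omega)
      exact hup z hz t ht htz
  unique m T T' hm hm' := by
    rcases eq_or_cellRank_lt (T.2.imp_right And.left) (T'.2.imp_right And.left) hm hm' le_rfl
      with h | h
    · exact Subtype.ext h.symm
    rcases eq_or_cellRank_lt (T'.2.imp_right And.left) (T.2.imp_right And.left) hm' hm le_rfl
      with h' | h'
    · exact Subtype.ext h'
    · exact absurd h h'.asymm
  notMem m T hm := by
    rintro ⟨A, hA, hAm⟩
    obtain ⟨hT, hm⟩ := mem_monomialCell_cellGenerator.1 hm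
    have hcard := Finset.card_compl_add_card m.support
    rw [Fintype.card_fin] at hcard
    have hTz := Finset.card_le_card hT
    have hAc := Finset.card_le_card hAm
    rw [h₁ A hA] at hAc
    unfold zeroSet at hTz
    rcases T.2 with h | ⟨h, hTA⟩
    · omega
    · apply hTA
      -- The d variables of A and the n - d missing ones in T leave no room, so A is the complement
      -- of T, which the index set excludes.
      have hAs : A = m.support := Finset.eq_of_subset_of_card_le hAm (by rw [h₁ A hA]; omega)
      have hTs : T.1 = zeroSet m := Finset.eq_of_subset_of_card_le hT (by unfold zeroSet; omega)
      rwa [hTs, zeroSet, compl_compl, ← hAs]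
  rank_lt m m' T T' hm hm' hle :=
    (eq_or_cellRank_lt (T.2.imp_right And.left) (T'.2.imp_right And.left) hm hm' hle).imp_left
      Subtype.ext

end SkeletonPartition

/-! ### Path ideals of cycles -/

section Cycle

open MvPolynomial

/-- The vertex sets of the paths with `m` vertices. -/
def pathSets {V : Type} [DecidableEq V] (G : SimpleGraph V) (m : ℕ) : Set (Finset V) :=
  {A | ∃ (a b : V) (p : G.Walk a b), p.IsPath ∧ p.support.length = m ∧ A = p.support.toFinset}

lemma card_of_mem_pathSets {V : Type} [DecidableEq V] {G : SimpleGraph V} {m : ℕ} {A : Finset V}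
    (hA : A ∈ pathSets G m) : A.card = m := by
  obtain ⟨a, b, p, hp, hm, rfl⟩ := hA
  rw [List.toFinset_card_of_nodup hp.support_nodup, hm]

lemma pathIdeal_eq_restrictSupportIdeal {K : Type u} [CommRing K] {n : ℕ} (G : SimpleGraph (Fin n))
    (m : ℕ) : pathIdeal K G m =
      restrictSupportIdeal (R := K) _ (isUpperSet_squarefreeSet (pathSets G m)) := by
  have hset : {f : MvPolynomial (Fin n) K | ∃ (a b : Fin n) (p : G.Walk a b), p.IsPath ∧
      p.support.length = m ∧ f = (p.support.map X).prod} =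
      (fun s => monomial s (1 : K)) '' ((fun A => ∑ i ∈ A, Finsupp.single i 1) '' pathSets G m) := by
    have hprod : ∀ {a b : Fin n} {p : G.Walk a b}, p.IsPath →
        monomial (∑ i ∈ p.support.toFinset, Finsupp.single i 1) (1 : K) =
          (p.support.map X).prod := by
      intro a b p hp
      rw [monomial_sum_one, List.prod_toFinset _ hp.support_nodup]
      rfl
    ext f
    constructor
    · rintro ⟨a, b, p, hp, hm, rfl⟩
      exact ⟨_, ⟨_, ⟨a, b, p, hp, hm, rfl⟩, rfl⟩, hprod hp⟩
    · rintro ⟨_, ⟨_, ⟨a, b, p, hp, hm, rfl⟩, rfl⟩, rfl⟩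
      exact ⟨a, b, p, hp, hm, hprod hp⟩
  have hle : ∀ (A : Finset (Fin n)) (k : Fin n →₀ ℕ),
      ∑ i ∈ A, Finsupp.single i 1 ≤ k ↔ A ⊆ k.support := by
    intro A k
    refine ⟨fun h j hj => ?_, fun h j => ?_⟩
    · have := h j
      rw [Finsupp.finsetSum_apply] at this
      simp only [Finsupp.single_apply, Finset.sum_ite_eq', if_pos hj] at this
      rw [Finsupp.mem_support_iff]
      omega
    · rw [Finsupp.finsetSum_apply]
      simp only [Finsupp.single_apply, Finset.sum_ite_eq']
      split_ifs with hj
      · exact Nat.one_le_iff_ne_zero.2 (Finsupp.mem_support_iff.1 (h hj))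
      · exact Nat.zero_le _
  ext f
  rw [pathIdeal, hset, mem_ideal_span_monomial_image, mem_restrictSupportIdeal]
  refine forall₂_congr fun k _ => ?_
  simp only [Set.exists_mem_image, hle]
  rfl

open scoped Fin.CommRing in
lemma exists_walk_cycleGraph {n : ℕ} (v : Fin (n + 2)) (k : ℕ) (hk : k < n + 2) :
    ∃ p : (SimpleGraph.cycleGraph (n + 2)).Walk v (v + k), p.IsPath ∧ p.support.length = k + 1 ∧
      ∀ w ∈ p.support, ∃ j ≤ k, w = v + (j : ℕ) := by
  induction k with
  | zero =>
    have h0 : v + ((0 : ℕ) : Fin (n + 2)) = v := by simp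
    rw [h0]
    exact ⟨.nil, .nil, rfl, fun w hw => ⟨0, le_rfl, by simpa using hw⟩⟩
  | succ k ih =>
    obtain ⟨p, hp, hlen, hsupp⟩ := ih (by omega)
    have hadj : (SimpleGraph.cycleGraph (n + 2)).Adj (v + k) (v + (k + 1 : ℕ)) := by
      rw [SimpleGraph.cycleGraph_adj]
      right
      push_cast
      abel
    refine ⟨p.concat hadj, hp.concat (fun hmem => ?_) hadj, ?_, ?_⟩
    · obtain ⟨j, hj, hjk⟩ := hsupp _ hmem
      have := congrArg Fin.val (add_left_cancel hjk)
      rw [Fin.val_natCast, Fin.val_natCast, Nat.mod_eq_of_lt hk, Nat.mod_eq_of_lt (by omega)] at this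
      omega
    · rw [SimpleGraph.Walk.support_concat, List.length_append, hlen]
      rfl
    · intro w hw
      rw [SimpleGraph.Walk.support_concat, List.mem_append,
        List.mem_singleton] at hw
      rcases hw with hw | rfl
      · obtain ⟨j, hj, rfl⟩ := hsupp w hw
        exact ⟨j, by omega, rfl⟩
      · exact ⟨k + 1, le_rfl, rfl⟩

open scoped Fin.CommRing in
lemma exists_mem_pathSets_cycleGraph {n m : ℕ} (hm : 1 ≤ m) (B : Finset (Fin n))
    (hB : n ≤ B.card + 1) (hmn : m < n) :
    ∃ A ∈ pathSets (SimpleGraph.cycleGraph n) m, A ⊆ B := by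
  obtain ⟨n, rfl⟩ : ∃ k, n = k + 2 := ⟨n - 2, by omega⟩
  obtain ⟨w, hw⟩ : ∃ w, ∀ j, j ≠ w → j ∈ B := by
    have hcard := Finset.card_compl_add_card B
    rw [Fintype.card_fin] at hcard
    obtain ⟨w, hw⟩ := Finset.card_le_one_iff_subset_singleton.1 (by omega : Bᶜ.card ≤ 1)
    refine ⟨w, fun j hj => ?_⟩
    by_contra hjB
    exact hj (Finset.mem_singleton.1 (hw (Finset.mem_compl.2 hjB)))
  -- Starting just after the only vertex w that may be missing from `B`, a path of `m` < n vertices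
  -- ends before returning to w.
  obtain ⟨p, hp, hlen, hsupp⟩ := exists_walk_cycleGraph (w + 1) (m - 1) (by omega)
  refine ⟨_, ⟨_, _, p, hp, by omega, rfl⟩, fun v hv => hw v ?_⟩
  obtain ⟨j, hj, rfl⟩ := hsupp v (List.mem_toFinset.1 hv)
  intro h
  rw [add_assoc, add_eq_left] at h
  have h' : ((1 + j : ℕ) : Fin (n + 2)) = 0 := by exact_mod_cast h
  have := congrArg Fin.val h'
  rw [Fin.val_natCast, Nat.mod_eq_of_lt (by omega), Fin.val_zero] at this
  omega

end Cycle

theorem proposition3p2 (K : Type u) [Field K] (n : ℕ) (hn : 3 ≤ n) :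
    (((n - 3 : ℕ) : ℕ∞) ≤ sdepthQuotient (cyclePathIdeal K n (n - 2)) ∧
      sdepthQuotient (cyclePathIdeal K n (n - 2)) ≤ ((n - 2 : ℕ) : ℕ∞)) ∧
    (((n - 3 : ℕ) : ℕ∞) ≤ depthQuotient (cyclePathIdeal K n (n - 2)) ∧
      depthQuotient (cyclePathIdeal K n (n - 2)) ≤ ((n - 2 : ℕ) : ℕ∞)) := by
  classical
  have hcyc : cyclePathIdeal K n (n - 2) = _ := pathIdeal_eq_restrictSupportIdeal _ _
  rw [hcyc]
  set 𝒜 := pathSets (SimpleGraph.cycleGraph n) (n - 2)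
  have h₁ : ∀ A ∈ 𝒜, A.card = n - 2 := fun A hA => card_of_mem_pathSets hA
  have h₂ : ∀ B : Finset (Fin n), n - 2 < B.card → ∃ A ∈ 𝒜, A ⊆ B := fun B hB =>
    exists_mem_pathSets_cycleGraph (by omega) B (by omega) (by omega)
  -- Since n ≥ 3, generators have positive degree and the ideal is proper.
  have h0 : (0 : Fin n →₀ ℕ) ∉ squarefreeSet 𝒜 := by
    rintro ⟨A, hA, hA0⟩
    have := h₁ A hA
    have := Finset.card_le_card hA0
    rw [Finsupp.support_zero, Finset.card_empty] at this
    omega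
  have hdim : ∀ m, m ∉ squarefreeSet 𝒜 → m.support.card ≤ n - 2 := by
    intro m hm
    by_contra! hlt
    exact hm (h₂ _ hlt)
  let c := skeletonPartition 𝒜 (n - 2) (by omega) h₁ h₂
  have hc : ∀ T, n - 3 ≤ (c.Z T).card := by
    intro T
    change n - 3 ≤ (T.1ᶜ).card
    have hcard := Finset.card_compl_add_card T.1
    rw [Fintype.card_fin] at hcard
    rcases T.2 with h | h <;> omega
  have hU := isUpperSet_squarefreeSet 𝒜
  exact ⟨⟨c.le_sdepthQuotient hU _ hc, sdepthQuotient_le hU h0 _ hdim⟩,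
    ⟨c.le_depthQuotient hU _ hc, depthQuotient_le hU h0 _ hdim⟩⟩
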